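/- Let $X=[0,1]\setminus\mathbb{Q}$, let $T:X\to X$, $T(x)=1/x \bmod 1$, be the Gauss map, with $T'(x)=-x^{-2}$, and let $I_{i_1\ldots i_n}\subset X$ be the set of points whose continued fraction expansion begins with the digits $i_1,\ldots,i_n\in\mathbb{N}=\{1,2,\ldots\}$. For a probability vector $\mathbf p=(p_n)_{n\in\mathbb{N}}$ let $\mu_{\mathbf p}$ be the image of the product measure on $\mathbb{N}^{\mathbb{N}}$ with marginals $\mathbf p$ under the continued fraction coding map, and let $\dim\mu_{\mathbf p}=\inf\{\dim_H A:\mu_{\mathbf p}(A)=1\}$. Put $\psi=|T'(z_1)|^{-1/4}$, where $z_1=(\sqrt5-1)/2$ is the fixed point of $T$ with all digits equal to $1$. Fix $\epsilon>0$. Let $\mathcal{P}_\epsilon$ be the set of probability vectors $\mathbf p$ with $p_n>0$ for all $n$, $(p_n)$ decreasing (in the weak sense), $p_n=O(n^{-2})$, $\dim\mu_{\mathbf p}>\frac34$, and either $p_1,p_2\ge\epsilon$ or $p_1>\psi$. For $\mathbf p\in\mathcal{P}_\epsilon$ put $f_{\mathbf p}(x)=\log p_n$ for $x\in I_n$. For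 $t\in[\frac18,\frac14]$ let $\beta_{\mathbf p}(t)\in[0,1]$ be the solution $b$ of $P(-b\log|T'|+tf_{\mathbf p})=0$, where $P(g)=\lim_{n\to\infty}\frac1n\log\sum_{T^nx=x}\exp\big(\sum_{k=0}^{n-1}g(T^kx)\big)$ is the topological pressure. Put $g_{\mathbf p,t}=-\beta_{\mathbf p}(t)\log|T'|+tf_{\mathbf p}$ and $\mathcal{L}_{\mathbf p,t}w(x)=\sum_{Ty=x}e^{g_{\mathbf p,t}(y)}w(y)$. Let $h_{\mathbf p,t}:X\to(0,\infty)$ be a positive eigenfunction, $\mathcal{L}_{\mathbf p,t}h_{\mathbf p,t}=h_{\mathbf p,t}$, that is bounded and locally Hölder (for some $\theta\in(0,1)$ and $C$, its oscillation over every $I_{i_1\ldots i_n}$, $n\ge1$, is at most $C\theta^n$); it is unique up to a constant factor. Put $\mathcal{M}_{\mathbf p,t}w=h_{\mathbf p,t}^{-1}\mathcal{L}_{\mathbf p,t}(h_{\mathbf p,t}w)$. For $a>0$ let $\mathcal{C}_a$ be the cone of all $w\in C([0,1])$ with $w\ge0$ and $w(x)\le e^{a|x-y|}w(y)$ for all $x,y\in[0,1]$;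 write $v\preceq w$ if $w-v\in\mathcal{C}_a$, and let $$\Theta(v,w)=\log\frac{\inf\{s>0:w\preceq sv\}}{\sup\{s>0:sv\preceq w\}}\in[0,\infty]$$ be the projective metric on the nonzero elements of $\mathcal{C}_a$ (with $\inf\emptyset=\infty$, $\sup\emptyset=0$). Then there exist $a>0$, $D<\infty$ and $r\in(0,1)$ such that for all $\mathbf p\in\mathcal{P}_\epsilon$ and all $t\in[\frac18,\frac14]$ the following hold. 1. For every nonzero $w\in\mathcal{C}_a$ the function $\mathcal{M}^2_{\mathbf p,t}w$ extends from $X$ to a (unique) continuous function on $[0,1]$, and the extension, again denoted $\mathcal{M}^2_{\mathbf p,t}w$, is a nonzero element of $\mathcal{C}_a$. For all nonzero $v,w\in\mathcal{C}_a$, $$\Theta(\mathcal{M}^2_{\mathbf p,t}v,\mathcal{M}^2_{\mathbf p,t}w)\le D\qquad\text{and}\qquad \Theta(\mathcal{M}^2_{\mathbf p,t}v,\mathcal{M}^2_{\mathbf p,t}w)\le r\,\Theta(v,w).$$ 2. For all $x,y\in X$, $$e^{-a|x-y|}\le\frac{h_{\mathbf p,t}(x)}{h_{\mathbf p,t}(y)}\le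 e^{a|x-y|}.$$ -/

import Mathlib

open Set Filter Topology MeasureTheory
open scoped ENNReal

namespace GaussGap

/-! ### The Gauss map and its coding -/

/-- `[0,1] \ ℚ`. -/
abbrev X : Type := {x : ℝ // x ∈ Icc (0 : ℝ) 1 ∧ Irrational x}

/-- The real formula `x ↦ 1 / x mod 1`. -/
noncomputable def gaussReal (x : ℝ) : ℝ := Int.fract (1 / x)

/-- The Gauss map `T : [0,1] \ ℚ → [0,1] \ ℚ`. -/
noncomputable def T (x : X) : X :=
  ⟨gaussReal x, ⟨Int.fract_nonneg _, (Int.fract_lt_one _).le⟩, by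
    have h : Irrational (1 / (x : ℝ)) := by simpa using x.2.2.inv
    exact h.sub_intCast ⌊1 / (x : ℝ)⌋⟩

theorem one_le_floor (x : X) : 0 < ⌊1 / (x : ℝ)⌋₊ := by
  have h0 : (0 : ℝ) < x := lt_of_le_of_ne x.2.1.1 (fun h => x.2.2.ne_zero h.symm)
  exact Nat.floor_pos.2 ((one_le_div h0).2 x.2.1.2)

/-- The first continued fraction digit of `x`. -/
noncomputable def digit (x : X) : ℕ+ := ⟨⌊1 / (x : ℝ)⌋₊, one_le_floor x⟩

/-- The cylinder `I_{i₁ … iₙ}`: the points whose first `n` continued fraction digits are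
`i₁, …, iₙ`. -/
def cylinder {n : ℕ} (i : Fin n → ℕ+) : Set X :=
  {x | ∀ k : Fin n, digit (T^[k] x) = i k}

/-- The finite continued fraction `1 / (i₁ + 1 / (i₂ + ⋯ + 1 / iₙ))`, that is
`T_{i₁}⁻¹ ∘ ⋯ ∘ T_{iₙ}⁻¹ (0)`. -/
noncomputable def convergent : (ℕ → ℕ+) → ℕ → ℝ
  | _, 0 => 0
  | i, n + 1 => 1 / (((i 0 : ℕ) : ℝ) + convergent (fun k => i (k + 1)) n)

/-- The coding map `Π`: the value of the infinite continued fraction with digits `i`. -/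
noncomputable def codingMap (i : ℕ → ℕ+) : ℝ := limUnder atTop (convergent i)

/-! ### Bernoulli measures and their dimension -/

instance : MeasurableSpace ℕ+ := ⊤

/-- The Bernoulli measure `μ_p` on `ℝ` (carried by `[0,1] \ ℚ`): the image under the coding map
of the product measure with marginals `p`. -/
noncomputable def bernoulli (p : PMF ℕ+) : Measure ℝ :=
  (Measure.infinitePi (fun _ : ℕ => p.toMeasure)).map codingMap

/-- The Hausdorff dimension of a probability measure. -/
noncomputable def measureDim (μ : Measure ℝ) : ℝ≥0∞ :=
  ⨅ (A : Set ℝ) (_ : MeasurableSet A) (_ : μ A = 1), dimH A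

/-- `ψ = |T'(z₁)|^{-1/4}`, where `z₁` is the fixed point of `T` all of whose digits are `1`. -/
noncomputable def psi : ℝ := 1 / |deriv gaussReal (codingMap (fun _ => 1))| ^ (1 / 4 : ℝ)

/-- The class of probability vectors that is considered. -/
structure Admissible (ε : ℝ) (p : PMF ℕ+) : Prop where
  pos : ∀ n, 0 < p n
  anti : Antitone p
  decay : ∃ K : ℝ, ∀ n : ℕ+, (p n).toReal ≤ K / ((n : ℕ) : ℝ) ^ 2
  dim : 3 / 4 < measureDim (bernoulli p)
  mass : (ε ≤ (p 1).toReal ∧ ε ≤ (p 2).toReal) ∨ psi < (p 1).toReal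

/-! ### Potentials, pressure and transfer operators -/

/-- The Bernoulli potential `f_p = ∑ log pₙ 1_{Iₙ}`. -/
noncomputable def bernoulliPotential (p : PMF ℕ+) (x : X) : ℝ := Real.log (p (digit x)).toReal

/-- The potential `-b log |T'| + t f_p`. -/
noncomputable def potential (p : PMF ℕ+) (b t : ℝ) (x : X) : ℝ :=
  -b * Real.log |deriv gaussReal x| + t * bernoulliPotential p x

/-- The sum of `exp (Sₙ g x)` over the points with `Tⁿ x = x`, with values in `[0, ∞]`. -/
noncomputable def periodicSum (g : X → ℝ) (n : ℕ) : ℝ≥0∞ :=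
  ∑' x : {x : X // T^[n] x = x}, ENNReal.ofReal (Real.exp (birkhoffSum T g n x))

/-- The topological pressure of `g` is `P`. -/
def HasPressure (g : X → ℝ) (P : EReal) : Prop :=
  Tendsto (fun n : ℕ => ENNReal.log (periodicSum g n) / (n : EReal)) atTop (𝓝 P)

/-- `β_p(t)`: the solution `b ∈ [0,1]` of `P(-b log |T'| + t f_p) = 0`. The solution is unique, so
that the infimum below is over a single point. -/
noncomputable def beta (p : PMF ℕ+) (t : ℝ) : ℝ :=
  sInf {b : ℝ | b ∈ Icc (0 : ℝ) 1 ∧ HasPressure (potential p b t) 0}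

/-- `g_{p,t} = -β_p(t) log |T'| + t f_p`. -/
noncomputable def gpt (p : PMF ℕ+) (t : ℝ) : X → ℝ := potential p (beta p t) t

/-- The transfer operator `ℒ_g w (x) = ∑_{T y = x} exp (g y) w y`. -/
noncomputable def transfer (g w : X → ℝ) (x : X) : ℝ :=
  ∑' y : {y : X // T y = x}, Real.exp (g y) * w y

/-- Bounded, locally Hölder functions: the variation over cylinders of length `n` is at most
`C αⁿ` for some `α ∈ (0,1)`. -/
def BoundedLocallyHolder (f : X → ℝ) : Prop :=
  (∃ B : ℝ, ∀ x, |f x| ≤ B) ∧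
  ∃ α ∈ Ioo (0 : ℝ) 1, ∃ C : ℝ, ∀ n : ℕ, 1 ≤ n → ∀ i : Fin n → ℕ+,
    ∀ x ∈ cylinder i, ∀ y ∈ cylinder i, |f x - f y| ≤ C * α ^ n

/-- `h` is a positive eigenfunction of `ℒ_g` for the eigenvalue `1` (such an `h` is unique up to
a constant factor). -/
structure IsEigenfunction (g h : X → ℝ) : Prop where
  holder : BoundedLocallyHolder h
  pos : ∀ x, 0 < h x
  fixed : transfer g h = h

/-- The normalised operator `ℳ w = h⁻¹ ℒ_g (h w)`. -/
noncomputable def normTransfer (g h w : X → ℝ) : X → ℝ := h⁻¹ * transfer g (h * w)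

/-! ### The cone and its projective metric -/

/-- `C([0,1])`. -/
abbrev V : Type := C(Icc (0 : ℝ) 1, ℝ)

/-- Restriction of a continuous function on `[0,1]` to the irrational points. -/
def res (w : V) (x : X) : ℝ := w ⟨x, x.2.1⟩

/-- The cone `C_a`. -/
def cone (a : ℝ) : Set V :=
  {w | (∀ x, 0 ≤ w x) ∧ ∀ x y : Icc (0 : ℝ) 1, w x ≤ Real.exp (a * |(x : ℝ) - y|) * w y}

/-- The partial order `v ⪯ w` of the cone (which contains `0`). -/
def coneLE (a : ℝ) (v w : V) : Prop := w - v ∈ cone a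

/-- `sup {s > 0 : s v ⪯ w}`, with supremum `0` of the empty set. -/
noncomputable def coneLower (a : ℝ) (v w : V) : ℝ≥0∞ :=
  ⨆ (s : ℝ) (_ : 0 < s) (_ : coneLE a (s • v) w), ENNReal.ofReal s

/-- `inf {s > 0 : w ⪯ s v}`, with infimum `∞` of the empty set. -/
noncomputable def coneUpper (a : ℝ) (v w : V) : ℝ≥0∞ :=
  ⨅ (s : ℝ) (_ : 0 < s) (_ : coneLE a w (s • v)), ENNReal.ofReal s

/-- The Hilbert projective metric `Θ` of `C_a` on nonzero elements of the cone, with values in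
`[0, ∞]` as a part of the extended reals. -/
noncomputable def projMetric (a : ℝ) (v w : V) : EReal :=
  ENNReal.log (coneUpper a v w / coneLower a v w)

end GaussGap

namespace GaussGap

/-! ### Hilbert metric of the cones of log-Lipschitz functions -/

/-! Everything rests on the log-Lipschitz constant along inverse branches. The Bernoulli part of the
potential is constant on each branch and `β ∈ [0,1]`, so two applications of the transfer operator
add at most 4 to the constant, while two branches contract distances by 4. Hence the constant 6 for
`h` reproduces itself under `h = ℒ²h` (`IsEigenfunction.le_exp_mul`), and `ℳ² w = h⁻¹ ℒ²(h w)` sends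
the constant `a` to `6 + 4 + (6 + a)/4`, which is at most `a/2` once `a ≥ 46`
(`exists_normTransfer_iterate_two_extension`).

Thus `ℳ²` maps `C_a` into `C_{a/2}`. The latter has finite diameter in the metric of `C_a`
(`projMetric_le_of_mem_half`), and Birkhoff's argument turns the finite diameter into contraction
(`projMetric_contract`). No constant depends on `p` or `t`, which is the uniformity claimed. -/

theorem dist_le_one (x y : Icc (0 : ℝ) 1) : |(x : ℝ) - y| ≤ 1 := by
  rw [abs_le]
  constructor <;> linarith [x.2.1, x.2.2, y.2.1, y.2.2]

theorem cone_le_exp_mul {a : ℝ} (ha : 0 ≤ a) {w : V} (hw : w ∈ cone a) (x y : Icc (0 : ℝ) 1) :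
    w x ≤ Real.exp a * w y := by
  refine (hw.2 x y).trans (mul_le_mul_of_nonneg_right (Real.exp_le_exp.2 ?_) (hw.1 y))
  nlinarith [dist_le_one x y]

theorem cone_pos {a : ℝ} (ha : 0 ≤ a) {w : V} (hw : w ∈ cone a) (h0 : w ≠ 0)
    (x : Icc (0 : ℝ) 1) : 0 < w x := by
  refine lt_of_le_of_ne (hw.1 x) fun hx => h0 ?_
  ext y
  have := cone_le_exp_mul ha hw y x
  rw [← hx, mul_zero] at this
  exact le_antisymm this (hw.1 y)

theorem zero_mem_cone (a : ℝ) : (0 : V) ∈ cone a := by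
  constructor <;> simp

theorem smul_mem_cone {a s : ℝ} (hs : 0 ≤ s) {w : V} (hw : w ∈ cone a) : s • w ∈ cone a := by
  refine ⟨fun x => mul_nonneg hs (hw.1 x), fun x y => ?_⟩
  have := mul_le_mul_of_nonneg_left (hw.2 x y) hs
  simpa [mul_left_comm] using this

theorem cone_mono {a b : ℝ} (hab : a ≤ b) : cone a ⊆ cone b := fun w hw => by
  refine ⟨hw.1, fun x y => (hw.2 x y).trans ?_⟩
  refine mul_le_mul_of_nonneg_right (Real.exp_le_exp.2 ?_) (hw.1 y)
  exact mul_le_mul_of_nonneg_right hab (abs_nonneg _)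

theorem isClosed_cone (a : ℝ) : IsClosed (cone a) := by
  have h : cone a = (⋂ x, {w : V | 0 ≤ w x}) ∩
      ⋂ x : Icc (0 : ℝ) 1, ⋂ y : Icc (0 : ℝ) 1,
        {w : V | w x ≤ Real.exp (a * |(x : ℝ) - y|) * w y} := by
    ext w
    simp only [cone, mem_ofPred_eq, mem_inter_iff, mem_iInter]
  rw [h]
  refine (isClosed_iInter fun x => isClosed_le continuous_const ?_).inter
    (isClosed_iInter fun x => isClosed_iInter fun y => isClosed_le ?_ ?_)
  · exact continuous_eval_const x
  · exact continuous_eval_const x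
  · exact continuous_const.mul (continuous_eval_const y)

theorem projMetric_le {a α β : ℝ} (hα : 0 < α) (hβ : 0 < β) {v w : V}
    (h1 : coneLE a (α • v) w) (h2 : coneLE a w (β • v)) :
    projMetric a v w ≤ (Real.log (β / α) : EReal) := by
  have hl : ENNReal.ofReal α ≤ coneLower a v w :=
    le_iSup_of_le α (le_iSup_of_le hα (le_iSup_of_le h1 le_rfl))
  have hu : coneUpper a v w ≤ ENNReal.ofReal β :=
    iInf_le_of_le β (iInf_le_of_le hβ (iInf_le_of_le h2 le_rfl))
  rw [projMetric, ← ENNReal.log_ofReal_of_pos (div_pos hβ hα), ENNReal.ofReal_div_of_pos hα]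
  exact ENNReal.log_monotone (ENNReal.div_le_div hu hl)

theorem coneLE.apply_le {a : ℝ} {v w : V} (h : coneLE a v w) (x : Icc (0 : ℝ) 1) : v x ≤ w x := by
  have := h.1 x
  simpa using this

/-- When the distance is finite, the extremal `α` and `β` are attained because the cone is closed.
-/
theorem projMetric_eq_top_or {a : ℝ} (ha : 0 ≤ a) {v w : V} (hv : v ∈ cone a) (hw : w ∈ cone a)
    (hv0 : v ≠ 0) (hw0 : w ≠ 0) :
    projMetric a v w = ⊤ ∨ ∃ α β : ℝ, 0 < α ∧ α ≤ β ∧ coneLE a (α • v) w ∧ coneLE a w (β • v) ∧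
      (Real.log (β / α) : EReal) ≤ projMetric a v w := by
  set x₀ : Icc (0 : ℝ) 1 := ⟨0, by simp⟩
  have hvx := cone_pos ha hv hv0 x₀
  have hwx := cone_pos ha hw hw0 x₀
  -- Evaluation at one point separates the admissible lower multiples from the upper ones. It also
  -- rules out `0 / 0` and `∞ / ∞` in the quotient that defines the metric.
  set q := w x₀ / v x₀
  have hq : 0 < q := div_pos hwx hvx
  set A : Set ℝ := {s | 0 < s ∧ coneLE a (s • v) w}
  set B : Set ℝ := {s | 0 < s ∧ coneLE a w (s • v)}
  have hA : ∀ s ∈ A, s ≤ q := fun s hs => by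
    rw [le_div_iff₀ hvx]
    simpa using hs.2.apply_le x₀
  have hB : ∀ s ∈ B, q ≤ s := fun s hs => by
    rw [div_le_iff₀ hvx]
    simpa using hs.2.apply_le x₀
  have hup : ENNReal.ofReal q ≤ coneUpper a v w :=
    le_iInf fun s => le_iInf fun h1 => le_iInf fun h2 => ENNReal.ofReal_le_ofReal (hB s ⟨h1, h2⟩)
  have hlow : coneLower a v w ≤ ENNReal.ofReal q :=
    iSup_le fun s => iSup_le fun h1 => iSup_le fun h2 => ENNReal.ofReal_le_ofReal (hA s ⟨h1, h2⟩)
  rcases A.eq_empty_or_nonempty with hAe | hAn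
  · left
    have h0 : coneLower a v w = 0 := by
      refine le_antisymm (iSup_le fun s => iSup_le fun h1 => iSup_le fun h2 => ?_) zero_le
      exact absurd (show s ∈ A from ⟨h1, h2⟩) (by simp [hAe])
    have h1 : coneUpper a v w ≠ 0 := ((ENNReal.ofReal_pos.2 hq).trans_le hup).ne'
    rw [projMetric, h0, ENNReal.div_zero h1, ENNReal.log_top]
  rcases B.eq_empty_or_nonempty with hBe | hBn
  · left
    have h0 : coneUpper a v w = ⊤ := by
      refine top_le_iff.1 (le_iInf fun s => le_iInf fun h1 => le_iInf fun h2 => ?_)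
      exact absurd (show s ∈ B from ⟨h1, h2⟩) (by simp [hBe])
    rw [projMetric, h0, ENNReal.top_div_of_ne_top (hlow.trans_lt ENNReal.ofReal_lt_top).ne,
      ENNReal.log_top]
  right
  have hAb : BddAbove A := ⟨q, hA⟩
  have hBb : BddBelow B := ⟨q, hB⟩
  have hα : 0 < sSup A := hAn.some_mem.1.trans_le (le_csSup hAb hAn.some_mem)
  have hαq : sSup A ≤ q := csSup_le hAn hA
  have hβq : q ≤ sInf B := le_csInf hBn hB
  have hβ : 0 < sInf B := hq.trans_le hβq
  refine ⟨sSup A, sInf B, hα, hαq.trans hβq, ?_, ?_, ?_⟩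
  · have hc : IsClosed {s : ℝ | coneLE a (s • v) w} :=
      (isClosed_cone a).preimage (by fun_prop : Continuous fun s : ℝ => w - s • v)
    exact closure_minimal (fun s hs => hs.2) hc (csSup_mem_closure hAn hAb)
  · have hc : IsClosed {s : ℝ | coneLE a w (s • v)} :=
      (isClosed_cone a).preimage (by fun_prop : Continuous fun s : ℝ => s • v - w)
    exact closure_minimal (fun s hs => hs.2) hc (csInf_mem_closure hBn hBb)
  · rw [projMetric, ← ENNReal.log_ofReal_of_pos (div_pos hβ hα), ENNReal.ofReal_div_of_pos hα]
    refine ENNReal.log_monotone (ENNReal.div_le_div ?_ ?_)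
    · exact le_iInf fun s => le_iInf fun h1 => le_iInf fun h2 =>
        ENNReal.ofReal_le_ofReal (csInf_le hBb ⟨h1, h2⟩)
    · exact iSup_le fun s => iSup_le fun h1 => iSup_le fun h2 =>
        ENNReal.ofReal_le_ofReal (le_csSup hAb ⟨h1, h2⟩)

/-- A multiple of an element of `C_{a/2}` is below another one in the order of `C_a` as soon as
it is at most a third of it pointwise. -/
theorem coneLE_of_three_mul_le {a : ℝ} (ha : 0 ≤ a) {v w : V} (hv : v ∈ cone (a / 2))
    (hw : w ∈ cone (a / 2)) (h : ∀ x, 3 * v x ≤ w x) : coneLE a v w := by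
  refine ⟨fun x => ?_, fun x y => ?_⟩
  · have := h x
    have := hv.1 x
    simp only [ContinuousMap.sub_apply]
    linarith
  · simp only [ContinuousMap.sub_apply]
    set u := Real.exp (a / 2 * |(x : ℝ) - y|) with hu
    have hu1 : 1 ≤ u := Real.one_le_exp (by positivity)
    have he : Real.exp (a * |(x : ℝ) - y|) = u * u := by
      rw [hu, ← Real.exp_add]
      ring_nf
    have h1 := hw.2 x y
    have h2 := hv.2 y x
    rw [abs_sub_comm, ← hu] at h2
    rw [← hu] at h1
    rw [he]
    have h3 := h y
    have hvx := hv.1 x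
    have hvy := hv.1 y
    -- The factor 3 enters through `u³ - 1 ≤ 3u²(u - 1)`, that is `u² + u + 1 ≤ 3u²` for `u ≥ 1`.
    have key : u * (u * u * v y - v x) ≤ u * (u * u * w y - w x) := by
      have e1 : u * (u * u * v y - v x) ≤ (u * u * u - 1) * v y := by nlinarith
      have e2 : (u * u * u - 1) * v y ≤ u * u * (u - 1) * (3 * v y) := by
        have : 0 ≤ (u - 1) * (u - 1) * (2 * u + 1) * v y := by
          have : 0 ≤ u - 1 := by linarith
          positivity
        nlinarith
      have e3 : u * u * (u - 1) * (3 * v y) ≤ u * u * (u - 1) * w y :=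
        mul_le_mul_of_nonneg_left h3 (mul_nonneg (by positivity) (by linarith))
      have e4 : u * u * (u - 1) * w y ≤ u * (u * u * w y - w x) := by nlinarith
      linarith
    have := le_of_mul_le_mul_left key (by linarith)
    linarith

/-- Elements of `C_{a/2}` oscillate by a factor at most `E = exp (a/2)`. Comparing both functions
with their values at 0 costs `E²` on each side, and the pointwise criterion costs 3 on each side,
whence `9E⁴ = 9 exp (2a)`. -/
theorem exists_coneLE_of_mem_half {a : ℝ} (ha : 0 ≤ a) {v w : V} (hv : v ∈ cone (a / 2))
    (hw : w ∈ cone (a / 2)) (hv0 : v ≠ 0) (hw0 : w ≠ 0) :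
    ∃ s : ℝ, 0 < s ∧ coneLE a (s • v) w ∧ coneLE a w ((9 * Real.exp (2 * a) * s) • v) := by
  set x₀ : Icc (0 : ℝ) 1 := ⟨0, by simp⟩
  have ha2 : 0 ≤ a / 2 := by positivity
  have hvx := cone_pos ha2 hv hv0 x₀
  have hwx := cone_pos ha2 hw hw0 x₀
  set E := Real.exp (a / 2) with hE
  have hEp : 0 < E := Real.exp_pos _
  have hE4 : Real.exp (2 * a) = E * E * (E * E) := by
    rw [hE, ← Real.exp_add, ← Real.exp_add]
    ring_nf
  have hs : 0 < w x₀ / (3 * (E * E) * v x₀) := by positivity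
  refine ⟨_, hs, coneLE_of_three_mul_le ha (smul_mem_cone hs.le hv) hw fun x => ?_,
    coneLE_of_three_mul_le ha hw (smul_mem_cone (by positivity) hv) fun x => ?_⟩
  · have hwp := cone_pos ha2 hw hw0 x
    have h1 := cone_le_exp_mul ha2 hv x x₀
    have h2 := cone_le_exp_mul ha2 hw x₀ x
    rw [← hE] at h1 h2
    simp only [ContinuousMap.smul_apply, smul_eq_mul]
    calc 3 * (w x₀ / (3 * (E * E) * v x₀) * v x)
        ≤ 3 * (E * w x / (3 * (E * E) * v x₀) * (E * v x₀)) := by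
          gcongr
          exact hv.1 x
      _ = w x := by field_simp
  · have h1 := cone_le_exp_mul ha2 hv x₀ x
    have h2 := cone_le_exp_mul ha2 hw x x₀
    rw [← hE] at h1 h2
    simp only [ContinuousMap.smul_apply, smul_eq_mul]
    rw [hE4]
    calc 3 * w x ≤ 3 * (E * w x₀) := by gcongr
      _ = 9 * (E * E * (E * E)) * (w x₀ / (3 * (E * E) * (E * v x))) * v x := by
          have := cone_pos ha2 hv hv0 x
          field_simp
          norm_num
      _ ≤ _ := by
          have := cone_pos ha2 hv hv0 x
          gcongr

theorem projMetric_le_of_mem_half {a : ℝ} (ha : 0 ≤ a) {v w : V} (hv : v ∈ cone (a / 2))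
    (hw : w ∈ cone (a / 2)) (hv0 : v ≠ 0) (hw0 : w ≠ 0) :
    projMetric a v w ≤ (Real.log (9 * Real.exp (2 * a)) : EReal) := by
  obtain ⟨s, hs, h1, h2⟩ := exists_coneLE_of_mem_half ha hv hw hv0 hw0
  have := projMetric_le hs (by positivity) h1 h2
  rwa [mul_div_assoc, div_self hs.ne', mul_one] at this

/-- The Möbius estimate behind Birkhoff's contraction theorem. -/
theorem log_birkhoff_le {x l s : ℝ} (hx : 1 ≤ x) (hl : 0 < l) (hs : 0 < s) (hs1 : s ≤ 1) :
    Real.log ((x + l) * (1 + l / s) / ((1 + l) * (x + l / s))) ≤ (1 - s) * Real.log x := by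
  have hx0 : 0 < x := by linarith
  have hy : 0 < 1 - s + s * x := by nlinarith
  -- Weighted AM-GM: `x ^ s ≤ 1 - s + s x`.
  have hb : s * Real.log x ≤ Real.log (1 - s + s * x) := by
    rw [← Real.log_rpow hx0]
    refine Real.log_le_log (by positivity) ?_
    have := Real.geom_mean_le_arith_mean2_weighted (sub_nonneg.2 hs1) hs.le zero_le_one hx0.le
      (by ring)
    simpa using this
  have hc : (x + l) * (1 + l / s) / ((1 + l) * (x + l / s)) ≤ x / (1 - s + s * x) := by
    have e : (x + l) * (1 + l / s) / ((1 + l) * (x + l / s)) =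
        (x + l) * (s + l) / ((1 + l) * (s * x + l)) := by
      field_simp
    rw [e, div_le_div_iff₀ (by positivity) hy]
    have hd : 0 ≤ (1 - s) * (x - 1) := mul_nonneg (by linarith) (by linarith)
    have : x * ((1 + l) * (s * x + l)) - (x + l) * (s + l) * (1 - s + s * x) =
        (1 - s) * (x - 1) * (l ^ 2 + s * l + s * x) := by ring
    have h2 : 0 ≤ (1 - s) * (x - 1) * (l ^ 2 + s * l + s * x) := mul_nonneg hd (by positivity)
    linarith
  calc _ ≤ Real.log (x / (1 - s + s * x)) := Real.log_le_log (by positivity) hc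
    _ = Real.log x - Real.log (1 - s + s * x) := Real.log_div hx0.ne' hy.ne'
    _ ≤ _ := by linarith

/-- The irrationals are dense in `[0,1]`. This makes the extension of `ℳ² w` unique and carries
linear relations from `X` over to `V`. -/
theorem res_injective : Function.Injective res := by
  intro v w h
  have hd : Dense {x : Icc (0 : ℝ) 1 | Irrational (x : ℝ)} := by
    intro x
    rw [closure_subtype]
    have hx : (x : ℝ) ∈ closure (Ioo (0 : ℝ) 1) := by
      rw [closure_Ioo zero_ne_one]
      exact x.2
    have h1 := closure_minimal (dense_irrational.open_subset_closure_inter isOpen_Ioo)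
      isClosed_closure hx
    refine closure_mono ?_ h1
    rintro y ⟨hy, hyi⟩
    exact ⟨⟨y, Ioo_subset_Icc_self hy⟩, hyi, rfl⟩
  refine DFunLike.coe_injective (Continuous.ext_on hd v.continuous w.continuous fun x hx => ?_)
  exact congrFun h ⟨x, x.2, hx⟩

/-- Birkhoff's contraction theorem for a linear operator that maps `C_a` into `C_{a/2}`. -/
theorem projMetric_contract {a : ℝ} (ha : 0 < a) {N : (X → ℝ) → X → ℝ}
    (hlin : ∀ (s u : ℝ) (v w : V), N (res (s • v + u • w)) = s • N (res v) + u • N (res w))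
    (hN : ∀ w ∈ cone a, w ≠ 0 → ∃ W ∈ cone (a / 2), W ≠ 0 ∧ res W = N (res w))
    {v w v' w' : V} (hv : v ∈ cone a) (hw : w ∈ cone a) (hv0 : v ≠ 0) (hw0 : w ≠ 0)
    (hv' : res v' = N (res v)) (hw' : res w' = N (res w)) :
    projMetric a v' w' ≤
      ((1 - (9 * Real.exp (2 * a))⁻¹ : ℝ) : EReal) * projMetric a v w := by
  set κ := 9 * Real.exp (2 * a) with hκ
  have hκ1 : 1 < κ := by
    have : 1 ≤ Real.exp (2 * a) := Real.one_le_exp (by positivity)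
    linarith
  have hκ0 : 0 < κ := by linarith
  have hr : 0 < 1 - κ⁻¹ := sub_pos.2 (inv_lt_one_of_one_lt₀ hκ1)
  rcases projMetric_eq_top_or ha.le hv hw hv0 hw0 with h | ⟨α, β, hα, hαβ, h1, h2, h3⟩
  · rw [h, EReal.coe_mul_top_of_pos hr]
    exact le_top
  have hβ : 0 < β := hα.trans_le hαβ
  refine le_trans ?_ (mul_le_mul_of_nonneg_left h3 (EReal.coe_nonneg.2 hr.le))
  rw [← EReal.coe_mul]
  have himg : ∀ s u : ℝ, ∀ z : V, res z = N (res (s • v + u • w)) → z = s • v' + u • w' :=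
    fun s u z hz => res_injective (by rw [hz, hlin, ← hv', ← hw']; rfl)
  have hlog : 0 ≤ (1 - κ⁻¹) * Real.log (β / α) :=
    mul_nonneg hr.le (Real.log_nonneg ((one_le_div hα).2 hαβ))
  -- Degenerate case: for proportional `v` and `w` one of the differences below may vanish, and `hN`
  -- says nothing about 0; the images are then proportional, at distance at most 0.
  have hprop : ∀ s : ℝ, 0 < s → w = s • v →
      projMetric a v' w' ≤ (((1 - κ⁻¹) * Real.log (β / α) : ℝ) : EReal) := by
    intro s hs hws
    have e : w' = s • v' := by
      have := himg s 0 w' (by rw [hw', hws]; simp)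
      simpa using this
    have h0 : coneLE a (s • v') w' ∧ coneLE a w' (s • v') := by
      simp only [coneLE, e, sub_self]
      exact ⟨zero_mem_cone a, zero_mem_cone a⟩
    refine (projMetric_le hs hs h0.1 h0.2).trans (EReal.coe_le_coe_iff.2 ?_)
    rw [div_self hs.ne', Real.log_one]
    exact hlog
  by_cases hP0 : w - α • v = 0
  · exact hprop α hα (sub_eq_zero.1 hP0)
  by_cases hQ0 : β • v - w = 0
  · exact hprop β hβ (sub_eq_zero.1 hQ0).symm
  obtain ⟨P, hP, hPn, hPr⟩ := hN _ h1 hP0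
  obtain ⟨Q, hQ, hQn, hQr⟩ := hN _ h2 hQ0
  have eP : P = (-α) • v' + (1 : ℝ) • w' := by
    refine himg _ _ P (hPr.trans ?_)
    congr 2
    module
  have eQ : Q = β • v' + (-1 : ℝ) • w' := by
    refine himg _ _ Q (hQr.trans ?_)
    congr 2
    module
  -- Solving `l P ⪯ Q ⪯ κ l P` for `w'` bounds it between two multiples of `v'`. Their ratio is the
  -- expression in `log_birkhoff_le` with `x = β/α` and `s = κ⁻¹`.
  obtain ⟨l, hl, k1, k2⟩ := exists_coneLE_of_mem_half ha.le hP hQ hPn hQn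
  rw [← hκ] at k2
  have m1 : coneLE a w' (((β + l * α) / (1 + l)) • v') := by
    have := smul_mem_cone (s := (1 + l)⁻¹) (by positivity) k1
    rw [eP, eQ] at this
    unfold coneLE
    convert this using 1
    ext x
    simp
    field_simp
    ring
  have m2 : coneLE a (((β + κ * l * α) / (1 + κ * l)) • v') w' := by
    have := smul_mem_cone (s := (1 + κ * l)⁻¹) (by positivity) k2
    rw [eP, eQ] at this
    unfold coneLE
    convert this using 1
    ext x
    simp
    field_simp
    ring
  refine (projMetric_le (by positivity) (by positivity) m2 m1).trans (EReal.coe_le_coe_iff.2 ?_)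
  have := log_birkhoff_le ((one_le_div hα).2 hαβ) hl (inv_pos.2 hκ0) (inv_le_one_of_one_le₀ hκ1.le)
  convert this using 2
  field_simp

/-! ### Inverse branches of the Gauss map -/

theorem X.pos (x : X) : (0 : ℝ) < x := lt_of_le_of_ne x.2.1.1 fun h => x.2.2.ne_zero h.symm

theorem X.lt_one (x : X) : (x : ℝ) < 1 := lt_of_le_of_ne x.2.1.2 fun h => x.2.2.ne_one h

theorem X.abs_sub_le_one (x y : X) : |(x : ℝ) - y| ≤ 1 := by
  rw [abs_le]
  constructor <;> linarith [x.pos, x.lt_one, y.pos, y.lt_one]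

theorem one_le_cast (n : ℕ+) : (1 : ℝ) ≤ ((n : ℕ) : ℝ) := by exact_mod_cast n.2

/-- The inverse branch `x ↦ 1 / (n + x)` of the Gauss map. -/
noncomputable def branch (n : ℕ+) (x : X) : X :=
  ⟨1 / (((n : ℕ) : ℝ) + x), by
    have := one_le_cast n
    have := x.pos
    constructor
    · positivity
    · exact (div_le_one (by linarith)).2 (by linarith), by
    have h : Irrational (((n : ℕ) : ℝ) + x) := x.2.2.natCast_add n
    simpa using h.inv⟩

theorem coe_branch (n : ℕ+) (x : X) : (branch n x : ℝ) = 1 / (((n : ℕ) : ℝ) + x) := rfl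

theorem T_branch (n : ℕ+) (x : X) : T (branch n x) = x := by
  apply Subtype.ext
  change Int.fract (1 / (1 / (((n : ℕ) : ℝ) + x))) = x
  rw [one_div_one_div, Int.fract_natCast_add]
  exact Int.fract_eq_self.2 ⟨x.pos.le, x.lt_one⟩

theorem digit_branch (n : ℕ+) (x : X) : digit (branch n x) = n := by
  apply PNat.eq
  change ⌊1 / (1 / (((n : ℕ) : ℝ) + x))⌋₊ = n
  rw [one_div_one_div, add_comm, Nat.floor_add_natCast x.pos.le, Nat.floor_eq_zero.2 x.lt_one,
    zero_add]

theorem branch_digit (y : X) : branch (digit y) (T y) = y := by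
  apply Subtype.ext
  change 1 / (((⌊1 / (y : ℝ)⌋₊ : ℕ) : ℝ) + Int.fract (1 / (y : ℝ))) = y
  rw [natCast_floor_eq_intCast_floor (one_div_pos.2 y.pos).le, Int.floor_add_fract,
    one_div_one_div]

/-- The preimages of a point under the Gauss map are indexed by their first digits. -/
noncomputable def preimageEquiv (x : X) : ℕ+ ≃ {y : X // T y = x} where
  toFun n := ⟨branch n x, T_branch n x⟩
  invFun y := digit y
  left_inv n := digit_branch n x
  right_inv := by
    rintro ⟨y, rfl⟩
    exact Subtype.ext (branch_digit y)

theorem transfer_eq (g w : X → ℝ) (x : X) :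
    transfer g w x = ∑' n : ℕ+, Real.exp (g (branch n x)) * w (branch n x) :=
  ((preimageEquiv x).tsum_eq fun y : {y : X // T y = x} => Real.exp (g y) * w y).symm

theorem abs_branch_sub (n : ℕ+) (x y : X) :
    |(branch n x : ℝ) - branch n y| =
      |(x : ℝ) - y| / ((((n : ℕ) : ℝ) + x) * (((n : ℕ) : ℝ) + y)) := by
  have := one_le_cast n
  have hx := x.pos
  have hy := y.pos
  have hp : 0 < (((n : ℕ) : ℝ) + x) * (((n : ℕ) : ℝ) + y) := by positivity
  rw [coe_branch, coe_branch, abs_sub_comm, eq_div_iff hp.ne', ← abs_of_pos hp, ← abs_mul]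
  congr 1
  field_simp
  ring

theorem abs_branch_sub_le (n : ℕ+) (x y : X) :
    |(branch n x : ℝ) - branch n y| ≤ |(x : ℝ) - y| := by
  have := one_le_cast n
  have hx := x.pos
  have hy := y.pos
  rw [abs_branch_sub]
  exact div_le_self (abs_nonneg _) (by nlinarith)

/-- The branch with digit 1 alone has derivative close to -1 near 0, so two steps are needed: the
denominators combine to `m(n + z) + 1 ≥ 2` at each of the two points. -/
theorem abs_branch_branch_sub_le (m n : ℕ+) (x y : X) :
    |(branch m (branch n x) : ℝ) - branch m (branch n y)| ≤ |(x : ℝ) - y| / 4 := by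
  have hm := one_le_cast m
  have hn := one_le_cast n
  have hx := x.pos
  have hy := y.pos
  have key : ∀ z : X, 2 ≤ (((m : ℕ) : ℝ) + branch n z) * (((n : ℕ) : ℝ) + z) := by
    intro z
    have hz := z.pos
    rw [coe_branch, add_mul, one_div, inv_mul_cancel₀ (by positivity)]
    nlinarith
  have kx := key x
  have ky := key y
  rw [abs_branch_sub, abs_branch_sub, div_div]
  refine div_le_div_of_nonneg_left (abs_nonneg _) (by norm_num) ?_
  nlinarith

/-! ### Distortion of the potential -/

/-- Bounded distortion of a potential along the inverse branches. -/
def BranchLipschitz (g : X → ℝ) : Prop :=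
  ∀ (n : ℕ+) (x y : X), g (branch n x) ≤ g (branch n y) + 2 * |(x : ℝ) - y|

theorem deriv_gaussReal (y : X) : deriv gaussReal y = -((y : ℝ) ^ 2)⁻¹ := by
  have hy := y.pos
  set k := ⌊1 / (y : ℝ)⌋ with hk
  have hirr : Irrational (1 / (y : ℝ)) := by simpa using y.2.2.inv
  have h1 : (k : ℝ) < 1 / (y : ℝ) :=
    lt_of_le_of_ne (Int.floor_le _) fun h => hirr.ne_int k h.symm
  have h2 : 1 / (y : ℝ) < k + 1 := Int.lt_floor_add_one _
  have hc : ContinuousAt (fun z : ℝ => 1 / z) y := continuousAt_const.div continuousAt_id hy.ne'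
  have hev : gaussReal =ᶠ[𝓝 (y : ℝ)] fun z => z⁻¹ - k := by
    filter_upwards [hc.eventually_const_lt h1, hc.eventually_lt_const h2] with z hz1 hz2
    have : ⌊1 / z⌋ = k := Int.floor_eq_iff.2 ⟨hz1.le, hz2⟩
    rw [gaussReal, Int.fract, this, one_div]
  rw [hev.deriv_eq]
  exact ((hasDerivAt_inv hy.ne').sub_const (k : ℝ)).deriv

theorem potential_branch (p : PMF ℕ+) (b t : ℝ) (n : ℕ+) (x : X) :
    potential p b t (branch n x) =
      -b * (2 * Real.log (((n : ℕ) : ℝ) + x)) + t * Real.log (p n).toReal := by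
  rw [potential, bernoulliPotential, digit_branch, deriv_gaussReal, abs_neg, coe_branch]
  congr 2
  rw [← inv_pow, one_div, inv_inv, abs_pow, Real.log_pow, Real.log_abs]
  norm_num

/-- The Bernoulli term cancels, and `log (n + x)` is 1-Lipschitz because `n ≥ 1`. -/
theorem branchLipschitz_potential (p : PMF ℕ+) {b : ℝ} (hb : b ∈ Icc (0 : ℝ) 1) (t : ℝ) :
    BranchLipschitz (potential p b t) := by
  intro n x y
  rw [potential_branch, potential_branch]
  have hn := one_le_cast n
  have hx := x.pos
  have hy := y.pos
  have h : Real.log (((n : ℕ) : ℝ) + y) - Real.log (((n : ℕ) : ℝ) + x) ≤ |(x : ℝ) - y| := by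
    rw [← Real.log_div (by positivity) (by positivity)]
    refine (Real.log_le_sub_one_of_pos (by positivity)).trans ?_
    rw [div_sub_one (by positivity), add_sub_add_left_eq_sub]
    rw [div_le_iff₀ (by positivity), abs_sub_comm]
    have := le_abs_self ((y : ℝ) - x)
    nlinarith [abs_nonneg ((y : ℝ) - x)]
  have h2 : b * (Real.log (((n : ℕ) : ℝ) + y) - Real.log (((n : ℕ) : ℝ) + x)) ≤
      1 * |(x : ℝ) - y| :=
    (mul_le_mul_of_nonneg_left h hb.1).trans (mul_le_mul_of_nonneg_right hb.2 (abs_nonneg _))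
  linarith

/-- No existence of a solution is needed, since `sInf ∅ = 0`. -/
theorem beta_mem (p : PMF ℕ+) (t : ℝ) : beta p t ∈ Icc (0 : ℝ) 1 := by
  unfold beta
  set S := {b : ℝ | b ∈ Icc (0 : ℝ) 1 ∧ HasPressure (potential p b t) 0}
  rcases S.eq_empty_or_nonempty with h | h
  · simp [h]
  · have hb : BddBelow S := ⟨0, fun s hs => hs.1.1⟩
    exact ⟨le_csInf h fun s hs => hs.1.1, (csInf_le hb h.some_mem).trans h.some_mem.1.2⟩

theorem branchLipschitz_gpt (p : PMF ℕ+) (t : ℝ) : BranchLipschitz (gpt p t) :=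
  branchLipschitz_potential p (beta_mem p t) t

/-! ### The transfer operator on functions dominated by the eigenfunction -/

variable {g h : X → ℝ}

theorem IsEigenfunction.hasSum (hh : IsEigenfunction g h) (x : X) :
    HasSum (fun n : ℕ+ => Real.exp (g (branch n x)) * h (branch n x)) (h x) := by
  have e : ∑' n : ℕ+, Real.exp (g (branch n x)) * h (branch n x) = h x := by
    rw [← transfer_eq, hh.fixed]
  have hs : Summable fun n : ℕ+ => Real.exp (g (branch n x)) * h (branch n x) := by
    -- A divergent series has `tsum` equal to 0, which contradicts `h x > 0`.
    by_contra hs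
    rw [tsum_eq_zero_of_not_summable hs] at e
    exact (hh.pos x).ne e
  rw [← e]
  exact hs.hasSum

/-- `F` is bounded by a multiple of `h`. -/
def Dominated (h F : X → ℝ) : Prop := ∃ B : ℝ, ∀ x, |F x| ≤ B * h x

theorem Dominated.summable (hh : IsEigenfunction g h) {F : X → ℝ} (hF : Dominated h F) (x : X) :
    Summable fun n : ℕ+ => Real.exp (g (branch n x)) * F (branch n x) := by
  obtain ⟨B, hB⟩ := hF
  refine Summable.of_norm_bounded ((hh.hasSum x).summable.mul_left B) fun n => ?_
  rw [norm_mul, Real.norm_of_nonneg (Real.exp_pos _).le, Real.norm_eq_abs, mul_left_comm]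
  exact mul_le_mul_of_nonneg_left (hB _) (Real.exp_pos _).le

theorem Dominated.hasSum (hh : IsEigenfunction g h) {F : X → ℝ} (hF : Dominated h F) (x : X) :
    HasSum (fun n : ℕ+ => Real.exp (g (branch n x)) * F (branch n x)) (transfer g F x) := by
  rw [transfer_eq]
  exact (hF.summable hh x).hasSum

theorem Dominated.transfer (hh : IsEigenfunction g h) {F : X → ℝ} (hF : Dominated h F) :
    Dominated h (transfer g F) := by
  have hF' := hF
  obtain ⟨B, hB⟩ := hF
  refine ⟨B, fun x => ?_⟩
  have h1 := hF'.hasSum hh x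
  have h2 := (hh.hasSum x).mul_left B
  have hb : ∀ n : ℕ+, |F (branch n x)| ≤ B * h (branch n x) := fun n => hB _
  rw [abs_le]
  constructor
  · refine hasSum_le (fun n => ?_) h2.neg h1
    have := mul_le_mul_of_nonneg_left (abs_le.1 (hb n)).1 (Real.exp_pos (g (branch n x))).le
    linarith
  · refine hasSum_le (fun n => ?_) h1 h2
    have := mul_le_mul_of_nonneg_left (abs_le.1 (hb n)).2 (Real.exp_pos (g (branch n x))).le
    linarith

theorem IsEigenfunction.dominated_self (hh : IsEigenfunction g h) : Dominated h h :=
  ⟨1, fun x => by rw [abs_of_pos (hh.pos x), one_mul]⟩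

theorem Dominated.transfer_pos (hh : IsEigenfunction g h) {F : X → ℝ} (hF : Dominated h F)
    (hpos : ∀ x, 0 < F x) (x : X) : 0 < GaussGap.transfer g F x := by
  rw [← (hF.hasSum hh x).tsum_eq]
  exact (hF.summable hh x).tsum_pos (fun n => (mul_pos (Real.exp_pos _) (hpos _)).le) 1
    (mul_pos (Real.exp_pos _) (hpos _))

theorem transfer_linear (hh : IsEigenfunction g h) {F G : X → ℝ} (hF : Dominated h F)
    (hG : Dominated h G) (s u : ℝ) :
    transfer g (s • F + u • G) = s • transfer g F + u • transfer g G := by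
  funext x
  rw [transfer_eq]
  have := (((hF.hasSum hh x).mul_left s).add ((hG.hasSum hh x).mul_left u)).tsum_eq
  simp only [Pi.add_apply, Pi.smul_apply, smul_eq_mul]
  rw [← this]
  refine tsum_congr fun n => ?_
  ring

/-- One application of the transfer operator costs the distortion of the potential. -/
theorem transfer_le (hg : BranchLipschitz g) (hh : IsEigenfunction g h) {F : X → ℝ}
    (hF : Dominated h F) (hpos : ∀ x, 0 ≤ F x) {K : ℝ} {x y : X}
    (hxy : ∀ n, F (branch n x) ≤ K * F (branch n y)) :
    transfer g F x ≤ Real.exp (2 * |(x : ℝ) - y|) * K * transfer g F y := by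
  refine hasSum_le (fun n => ?_) (hF.hasSum hh x) ((hF.hasSum hh y).mul_left _)
  have h1 : Real.exp (g (branch n x)) ≤
      Real.exp (2 * |(x : ℝ) - y|) * Real.exp (g (branch n y)) := by
    rw [← Real.exp_add]
    exact Real.exp_le_exp.2 (by linarith [hg n x y])
  calc Real.exp (g (branch n x)) * F (branch n x)
      ≤ (Real.exp (2 * |(x : ℝ) - y|) * Real.exp (g (branch n y))) * (K * F (branch n y)) :=
        mul_le_mul h1 (hxy n) (hpos _) (by positivity)
    _ = _ := by ring

theorem transfer_nonneg {F : X → ℝ} (hpos : ∀ x, 0 ≤ F x) (x : X) : 0 ≤ transfer g F x :=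
  tsum_nonneg fun _ => mul_nonneg (Real.exp_pos _).le (hpos _)

theorem transfer_transfer_le (hg : BranchLipschitz g) (hh : IsEigenfunction g h) {F : X → ℝ}
    (hF : Dominated h F) (hpos : ∀ x, 0 ≤ F x) {K : ℝ} (hK : 0 ≤ K) {x y : X}
    (hxy : ∀ m n, F (branch m (branch n x)) ≤ K * F (branch m (branch n y))) :
    transfer g (transfer g F) x ≤
      Real.exp (4 * |(x : ℝ) - y|) * K * transfer g (transfer g F) y := by
  have h1 : ∀ n, transfer g F (branch n x) ≤
      Real.exp (2 * |(x : ℝ) - y|) * K * transfer g F (branch n y) := fun n => by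
    refine (transfer_le hg hh hF hpos (fun m => hxy m n)).trans ?_
    have := abs_branch_sub_le n x y
    have := transfer_nonneg (g := g) hpos (branch n y)
    gcongr
  have h2 := transfer_le hg hh (hF.transfer hh) (transfer_nonneg hpos)
    (K := Real.exp (2 * |(x : ℝ) - y|) * K) h1
  rwa [← mul_assoc, ← Real.exp_add, ← add_mul, show (2 : ℝ) + 2 = 4 by norm_num] at h2

/-! ### Regularity of the eigenfunction -/

/-- `x` and `y` have the same first `k` digits. -/
def SameDigits (k : ℕ) (x y : X) : Prop := ∀ j < k, digit (T^[j] x) = digit (T^[j] y)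

theorem SameDigits.branch {k : ℕ} {x y : X} (hxy : SameDigits k x y) (n : ℕ+) :
    SameDigits (k + 1) (branch n x) (branch n y) := by
  intro j hj
  cases j with
  | zero => simp [digit_branch]
  | succ j =>
    rw [Function.iterate_succ_apply, Function.iterate_succ_apply, T_branch, T_branch]
    exact hxy j (by omega)

/-- The fixed point `(√5 - 1) / 2` of the Gauss map. -/
theorem exists_branch_one_fixed : ∃ z : X, GaussGap.branch 1 z = z := by
  have h5 := Nat.Prime.irrational_sqrt (p := 5) (by norm_num)
  rw [Nat.cast_ofNat] at h5
  have hs : Real.sqrt 5 ^ 2 = 5 := Real.sq_sqrt (by norm_num)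
  have hs1 : 1 < Real.sqrt 5 := by
    rw [Real.lt_sqrt] <;> norm_num
  have hs2 : Real.sqrt 5 < 3 := by
    rw [Real.sqrt_lt] <;> norm_num
  have hi : Irrational ((Real.sqrt 5 - 1) / 2) := by
    have := (h5.sub_intCast 1).div_natCast (m := 2) (by norm_num)
    simpa using this
  refine ⟨⟨(Real.sqrt 5 - 1) / 2, ⟨by linarith, by linarith⟩, hi⟩, Subtype.ext ?_⟩
  rw [coe_branch, PNat.one_coe, Nat.cast_one]
  change 1 / (1 + (Real.sqrt 5 - 1) / 2) = (Real.sqrt 5 - 1) / 2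
  rw [div_eq_iff (by linarith)]
  nlinarith

theorem BoundedLocallyHolder.sameDigits (hh : BoundedLocallyHolder h) :
    ∃ α ∈ Ioo (0 : ℝ) 1, ∃ C : ℝ, ∀ k : ℕ, 1 ≤ k → ∀ x y, SameDigits k x y →
      h x ≤ h y + C * α ^ k := by
  obtain ⟨-, α, hα, C, hC⟩ := hh
  refine ⟨α, hα, C, fun k hk x y hxy => ?_⟩
  have := hC k hk (fun j => digit (T^[j] x)) x (fun j => rfl) y (fun j => (hxy j j.2).symm)
  linarith [(abs_le.1 this).2]

/-- Let `z` be the fixed point with all digits 1. By Hölder continuity `h ≥ h z / 2` on a small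
cylinder around `z`. Keeping only the digit-1 term of `ℒh = h` passes a lower bound from a cylinder
around `z` to the one with one digit fewer, at the cost of a factor `exp (g z - 2)`; finitely many
steps reach all of `X`. -/
theorem IsEigenfunction.exists_lower_bound (hg : BranchLipschitz g) (hh : IsEigenfunction g h) :
    ∃ c : ℝ, 0 < c ∧ ∀ x, c ≤ h x := by
  obtain ⟨z, hz⟩ := exists_branch_one_fixed
  obtain ⟨α, hα, C, hC⟩ := hh.holder.sameDigits
  have hlim : Tendsto (fun k : ℕ => C * α ^ k) atTop (𝓝 0) := by
    simpa using (tendsto_pow_atTop_nhds_zero_of_lt_one hα.1.le hα.2).const_mul C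
  have hz2 : 0 < h z / 2 := half_pos (hh.pos z)
  obtain ⟨k, hk1, hk⟩ := ((eventually_ge_atTop 1).and (hlim.eventually_lt_const hz2)).exists
  have base : ∀ x, SameDigits k x z → h z / 2 ≤ h x := fun x hx => by
    have := hC k hk1 z x (fun j hj => (hx j hj).symm)
    linarith
  have step : ∀ j ≤ k, ∃ c : ℝ, 0 < c ∧ ∀ x, SameDigits (k - j) x z → c ≤ h x := by
    intro j
    induction j with
    | zero => exact fun _ => ⟨h z / 2, hz2, base⟩
    | succ j ih =>
      intro hj
      obtain ⟨c, hc, hcx⟩ := ih (by omega)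
      refine ⟨Real.exp (g z - 2) * c, by positivity, fun x hx => ?_⟩
      have h1 : SameDigits (k - j) (GaussGap.branch 1 x) z := by
        have := hx.branch 1
        rwa [hz, show k - (j + 1) + 1 = k - j by omega] at this
      have h2 : Real.exp (g (GaussGap.branch 1 x)) * h (GaussGap.branch 1 x) ≤ h x :=
        le_hasSum (hh.hasSum x) 1 fun n _ => (mul_pos (Real.exp_pos _) (hh.pos _)).le
      have h3 := hg 1 z x
      rw [hz] at h3
      have h4 := z.abs_sub_le_one x
      refine le_trans (mul_le_mul (Real.exp_le_exp.2 ?_) (hcx _ h1) hc.le (Real.exp_pos _).le) h2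
      linarith
  obtain ⟨c, hc, hcx⟩ := step k le_rfl
  exact ⟨c, hc, fun x => hcx x fun j hj => absurd hj (by omega)⟩

/-- For points with `k` common digits the Hölder bound, made multiplicative by the lower bound `c`,
gives the estimate up to a factor `K`. Applying `h = ℒ²h` keeps `K` and the exponent 6 while asking
for fewer common digits, down to none. Finally `k → ∞` sends `K` to 1. -/
theorem IsEigenfunction.le_exp_mul (hg : BranchLipschitz g) (hh : IsEigenfunction g h) (x y : X) :
    h x ≤ Real.exp (6 * |(x : ℝ) - y|) * h y := by
  obtain ⟨c, hc, hcx⟩ := hh.exists_lower_bound hg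
  obtain ⟨α, hα, C, hC⟩ := hh.holder.sameDigits
  have hh2 : transfer g (transfer g h) = h := by rw [hh.fixed, hh.fixed]
  have key : ∀ k : ℕ, 1 ≤ k →
      h x ≤ (1 + |C| * α ^ k / c) * (Real.exp (6 * |(x : ℝ) - y|) * h y) := by
    intro k hk
    set K := 1 + |C| * α ^ k / c with hK
    have hα0 := hα.1
    have hK0 : 0 ≤ K := by positivity
    have base : ∀ x y, SameDigits k x y → h x ≤ K * h y := fun x y hxy => by
      have h1 := hC k hk x y hxy
      have h2 : C * α ^ k ≤ |C| * α ^ k / c * h y := by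
        have : C * α ^ k ≤ |C| * α ^ k := by
          gcongr
          exact le_abs_self C
        refine this.trans ?_
        rw [div_mul_eq_mul_div, le_div_iff₀ hc]
        gcongr
        exact hcx y
      rw [hK, add_mul, one_mul]
      linarith
    have step : ∀ j : ℕ, ∀ x y, SameDigits (k - j) x y →
        h x ≤ K * (Real.exp (6 * |(x : ℝ) - y|) * h y) := by
      intro j
      induction j with
      | zero =>
        intro x y hxy
        refine (base x y hxy).trans (mul_le_mul_of_nonneg_left ?_ hK0)
        exact le_mul_of_one_le_left (hh.pos y).le (Real.one_le_exp (by positivity))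
      | succ j ih =>
        intro x y hxy
        have h1 : ∀ m n, h (GaussGap.branch m (GaussGap.branch n x)) ≤
            K * Real.exp (6 * (|(x : ℝ) - y| / 4)) *
              h (GaussGap.branch m (GaussGap.branch n y)) := fun m n => by
          refine (ih _ _ fun i hi => ((hxy.branch n).branch m) i (by omega)).trans ?_
          rw [mul_assoc]
          have := abs_branch_branch_sub_le m n x y
          have := hh.pos (GaussGap.branch m (GaussGap.branch n y))
          gcongr
        have h2 := transfer_transfer_le hg hh hh.dominated_self (fun x => (hh.pos x).le)
          (by positivity) h1
        rw [hh2] at h2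
        refine h2.trans (le_of_eq_of_le (b := K * (Real.exp (4 * |(x : ℝ) - y|) *
          Real.exp (6 * (|(x : ℝ) - y| / 4)) * h y)) (by ring) ?_)
        rw [← Real.exp_add]
        have := hh.pos y
        have := abs_nonneg ((x : ℝ) - y)
        gcongr
        -- The constant 6 survives because `4 + 6/4 ≤ 6`.
        linarith
    exact step k x y fun j hj => absurd hj (by omega)
  have hlim : Tendsto (fun k : ℕ => (1 + |C| * α ^ k / c) * (Real.exp (6 * |(x : ℝ) - y|) * h y))
      atTop (𝓝 ((1 + |C| * 0 / c) * (Real.exp (6 * |(x : ℝ) - y|) * h y))) :=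
    ((((tendsto_pow_atTop_nhds_zero_of_lt_one hα.1.le hα.2).const_mul |C|).div_const c).const_add
      1).mul_const _
  have := ge_of_tendsto hlim ((eventually_ge_atTop 1).mono key)
  simpa using this

/-! ### The normalised operator on the cone -/

theorem normTransfer_iterate_two (hh : IsEigenfunction g h) (w : X → ℝ) :
    (normTransfer g h)^[2] w = h⁻¹ * transfer g (transfer g (h * w)) := by
  change h⁻¹ * transfer g (h * (h⁻¹ * transfer g (h * w))) = _
  congr 2
  funext x
  simp [(hh.pos x).ne']

theorem dominated_mul_res (hh : IsEigenfunction g h) (w : V) : Dominated h (h * res w) := by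
  refine ⟨‖w‖, fun x => ?_⟩
  rw [Pi.mul_apply, abs_mul, abs_of_pos (hh.pos x), mul_comm]
  exact mul_le_mul_of_nonneg_right (w.norm_coe_le_norm _) (hh.pos x).le

theorem normTransfer_iterate_two_linear (hh : IsEigenfunction g h) (s u : ℝ) (v w : V) :
    (normTransfer g h)^[2] (res (s • v + u • w)) =
      s • (normTransfer g h)^[2] (res v) + u • (normTransfer g h)^[2] (res w) := by
  have hv := dominated_mul_res hh v
  have hw := dominated_mul_res hh w
  have e : h * res (s • v + u • w) = s • (h * res v) + u • (h * res w) := by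
    funext x
    simp [res]
    ring
  simp only [normTransfer_iterate_two hh]
  rw [e, transfer_linear hh hv hw, transfer_linear hh (hv.transfer hh) (hw.transfer hh)]
  simp [mul_add]

/-- A positive log-Lipschitz function on the irrationals extends to a member of the cone. -/
theorem exists_extension {a : ℝ} (ha : 0 ≤ a) {F : X → ℝ} (hpos : ∀ x, 0 < F x)
    (hF : ∀ x y : X, F x ≤ Real.exp (a * |(x : ℝ) - y|) * F y) :
    ∃ W ∈ cone a, W ≠ 0 ∧ res W = F := by
  classical
  set f : Icc (0 : ℝ) 1 → ℝ := fun x => if hx : Irrational (x : ℝ) then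
    Real.log (F ⟨x, x.2, hx⟩) else 0 with hf
  have hlip : LipschitzOnWith ⟨a, ha⟩ f {x | Irrational (x : ℝ)} := by
    refine LipschitzOnWith.of_le_add_mul _ fun x hx y hy => ?_
    have hx' : Irrational (x : ℝ) := hx
    have hy' : Irrational (y : ℝ) := hy
    simp only [hf, dif_pos hx', dif_pos hy']
    have h1 := Real.log_le_log (hpos _) (hF ⟨x, x.2, hx⟩ ⟨y, y.2, hy⟩)
    rw [Real.log_mul (Real.exp_pos _).ne' (hpos _).ne', Real.log_exp] at h1
    rw [Subtype.dist_eq, Real.dist_eq]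
    exact h1.trans_eq (add_comm _ _)
  obtain ⟨G, hG, hGf⟩ := hlip.extend_real
  refine ⟨⟨fun x => Real.exp (G x), Real.continuous_exp.comp hG.continuous⟩,
    ⟨fun x => (Real.exp_pos _).le, fun x y => ?_⟩, fun h0 => ?_, ?_⟩
  · change Real.exp (G x) ≤ Real.exp (a * |(x : ℝ) - y|) * Real.exp (G y)
    rw [← Real.exp_add]
    have := hG.le_add_mul x y
    rw [Subtype.dist_eq, Real.dist_eq] at this
    exact Real.exp_le_exp.2 (this.trans_eq (add_comm _ _))
  · have := DFunLike.congr_fun h0 ⟨0, by simp⟩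
    exact (Real.exp_pos _).ne' this
  · funext x
    change Real.exp (G ⟨x, x.2.1⟩) = F x
    rw [← hGf (show Irrational (x : ℝ) from x.2.2)]
    simp only [hf, dif_pos x.2.2]
    exact Real.exp_log (hpos x)

theorem exists_normTransfer_iterate_two_extension {a : ℝ} (ha : 46 ≤ a) (hg : BranchLipschitz g)
    (hh : IsEigenfunction g h) {w : V} (hw : w ∈ cone a) (hw0 : w ≠ 0) :
    ∃ W ∈ cone (a / 2), W ≠ 0 ∧ res W = (normTransfer g h)^[2] (res w) := by
  have hdom := dominated_mul_res hh w
  have hpos : ∀ x, 0 < (h * res w) x := fun x =>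
    mul_pos (hh.pos x) (cone_pos (by linarith) hw hw0 _)
  have hpos2 := (hdom.transfer hh).transfer_pos hh (hdom.transfer_pos hh hpos)
  rw [normTransfer_iterate_two hh]
  refine exists_extension (by linarith) (fun x => mul_pos (inv_pos.2 (hh.pos x)) (hpos2 x))
    fun x y => ?_
  set d := |(x : ℝ) - y| with hd
  have hd0 : 0 ≤ d := abs_nonneg _
  have h1 : ∀ m n, (h * res w) (branch m (branch n x)) ≤
      Real.exp ((6 + a) * (d / 4)) * (h * res w) (branch m (branch n y)) := fun m n => by
    have hc := abs_branch_branch_sub_le m n x y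
    have e1 := hh.le_exp_mul hg (branch m (branch n x)) (branch m (branch n y))
    have e2 := hw.2 ⟨_, (branch m (branch n x)).2.1⟩ ⟨_, (branch m (branch n y)).2.1⟩
    have e3 := mul_le_mul e1 e2 (hw.1 _)
      (mul_nonneg (Real.exp_pos _).le (hh.pos _).le)
    refine e3.trans ?_
    rw [mul_mul_mul_comm, ← Real.exp_add, ← add_mul]
    refine mul_le_mul_of_nonneg_right (a := (h * res w) (branch m (branch n y))) (Real.exp_le_exp.2 ?_) (hpos _).le
    exact mul_le_mul_of_nonneg_left hc (by linarith)
  have h2 := transfer_transfer_le hg hh hdom (fun x => (hpos x).le) (Real.exp_pos _).le h1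
  have h3 := hh.le_exp_mul hg y x
  rw [abs_sub_comm, ← hd] at h3
  have hx := hh.pos x
  have hy := hh.pos y
  have h4 : (h x)⁻¹ ≤ Real.exp (6 * d) * (h y)⁻¹ := by
    rw [← div_eq_mul_inv, le_div_iff₀ hy, inv_mul_le_iff₀ hx, mul_comm]
    exact h3
  rw [← hd, ← Real.exp_add] at h2
  have h5 := mul_le_mul h4 h2 (hpos2 x).le (by positivity)
  refine h5.trans ?_
  rw [mul_mul_mul_comm, ← Real.exp_add]
  refine mul_le_mul_of_nonneg_right (Real.exp_le_exp.2 ?_)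
    (mul_pos (inv_pos.2 hy) (hpos2 y)).le
  -- The total exponent is `6d + 4d + (6 + a)d/4`, at most `(a/2)d` exactly because `a ≥ 46`.
  nlinarith

end GaussGap

/-- `W` and `W'` are the (unique) continuous functions on `[0,1]` that agree with `ℳ² w` and
`ℳ² w'` on `[0,1] \ ℚ`. -/
theorem lemma4p11 (ε : ℝ) (hε : 0 < ε) :
    ∃ a : ℝ, 0 < a ∧ ∃ D : ℝ, ∃ r ∈ Set.Ioo (0 : ℝ) 1,
      ∀ p : PMF ℕ+, GaussGap.Admissible ε p → ∀ t ∈ Set.Icc (1 / 8 : ℝ) (1 / 4),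
      ∀ h : GaussGap.X → ℝ, GaussGap.IsEigenfunction (GaussGap.gpt p t) h →
        (∀ w ∈ GaussGap.cone a, w ≠ 0 → ∀ w' ∈ GaussGap.cone a, w' ≠ 0 →
          ∃ W ∈ GaussGap.cone a, ∃ W' ∈ GaussGap.cone a, W ≠ 0 ∧ W' ≠ 0 ∧
            GaussGap.res W =
              (GaussGap.normTransfer (GaussGap.gpt p t) h)^[2] (GaussGap.res w) ∧
            GaussGap.res W' =
              (GaussGap.normTransfer (GaussGap.gpt p t) h)^[2] (GaussGap.res w') ∧
            GaussGap.projMetric a W W' ≤ (D : EReal) ∧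
            GaussGap.projMetric a W W' ≤ (r : EReal) * GaussGap.projMetric a w w') ∧
        (∀ x y : GaussGap.X,
          Real.exp (-a * |(x : ℝ) - y|) ≤ h x / h y ∧
          h x / h y ≤ Real.exp (a * |(x : ℝ) - y|)) := by
  refine ⟨46, by norm_num, Real.log (9 * Real.exp (2 * 46)), 1 - (9 * Real.exp (2 * 46))⁻¹,
    ⟨?_, ?_⟩, ?_⟩
  · refine sub_pos.2 (inv_lt_one_of_one_lt₀ ?_)
    linarith [Real.one_le_exp (show (0 : ℝ) ≤ 2 * 46 by norm_num)]
  · exact sub_lt_self 1 (by positivity)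
  intro p _ t _ h hh
  have hg := GaussGap.branchLipschitz_gpt p t
  refine ⟨fun w hw hw0 w' hw' hw0' => ?_, fun x y => ?_⟩
  · have hN := fun (u : GaussGap.V) (hu : u ∈ GaussGap.cone 46) (hu0 : u ≠ 0) =>
      GaussGap.exists_normTransfer_iterate_two_extension le_rfl hg hh hu hu0
    obtain ⟨W, hW, hWn, hWr⟩ := hN w hw hw0
    obtain ⟨W', hW', hWn', hWr'⟩ := hN w' hw' hw0'
    have hsub := GaussGap.cone_mono (show (46 / 2 : ℝ) ≤ 46 by norm_num)
    exact ⟨W, hsub hW, W', hsub hW', hWn, hWn', hWr, hWr',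
      GaussGap.projMetric_le_of_mem_half (by norm_num) hW hW' hWn hWn',
      GaussGap.projMetric_contract (by norm_num)
        (GaussGap.normTransfer_iterate_two_linear hh) hN hw hw' hw0 hw0' hWr hWr'⟩
  · have hxy : ∀ x y : GaussGap.X, h x / h y ≤ Real.exp (46 * |(x : ℝ) - y|) := fun x y => by
      rw [div_le_iff₀ (hh.pos y)]
      refine (hh.le_exp_mul hg x y).trans
        (mul_le_mul_of_nonneg_right (Real.exp_le_exp.2 ?_) (hh.pos y).le)
      exact mul_le_mul_of_nonneg_right (by norm_num) (abs_nonneg _)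
    refine ⟨?_, hxy x y⟩
    rw [neg_mul, Real.exp_neg, ← inv_div, abs_sub_comm]
    exact inv_anti₀ (div_pos (hh.pos y) (hh.pos x)) (hxy y x)
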